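/- Let $a\in[0,1]$ and $\gamma\in\mathbb C\setminus\{0\}$. For a complex-valued $q\in L_2(0,1)$ let $\mathcal L(q,a,\gamma)$ be the boundary value problem $$-y''(x)+q(x)y(a)=\lambda y(x),\quad 0<x<1,\qquad y(0)=\gamma y(1),\quad y'(0)=\gamma y'(1),$$ with $y\in W_2^2[0,1]$. Its spectrum consists of its eigenvalues counted with algebraic multiplicity, that is, with the order of $\lambda$ as a zero of the characteristic function $$\Delta(\lambda)=\det\begin{pmatrix}C(0,\lambda)-\gamma C(1,\lambda)&S(0,\lambda)-\gamma S(1,\lambda)\\ C'(0,\lambda)-\gamma C'(1,\lambda)&S'(0,\lambda)-\gamma S'(1,\lambda)\end{pmatrix},$$ where $C$ and $S$ are the solutions of the equation with $C(a,\lambda)=S'(a,\lambda)=1$, $C'(a,\lambda)=S(a,\lambda)=0$, and the prime denotes differentiation with respect to $x$. Put $$q_a(x)=q(x+a)\ \text{ for } x\in(0,1-a),\qquad q_a(x)=\tfrac1\gamma\,q(x+a-1)\ \text{ for } x\in(1-a,1).$$ Let $q,\tilde q\in L_2(0,1)$. (i) Let $\gamma\ne\pm1$. If the spectra of $\mathcal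 L(q,a,\gamma)$ and $\mathcal L(\tilde q,a,\gamma)$ coincide (with multiplicities), then $q=\tilde q$ a.e. on $(0,1)$. (ii) Let $\gamma\in\{1,-1\}$. Assume that there is an operator $K:L_2(0,1/2)\to L_2(0,1/2)$ (an arbitrary map, not necessarily linear) such that $I+\gamma K$ is injective, where $I$ is the identity operator, and $$q_a\Big(\frac12-x\Big)=K\Big(q_a\Big(\frac12+x\Big)\Big),\qquad \tilde q_a\Big(\frac12-x\Big)=K\Big(\tilde q_a\Big(\frac12+x\Big)\Big)\quad\text{for a.e. } x\in\Big(0,\frac12\Big).$$ If the spectra of $\mathcal L(q,a,\gamma)$ and $\mathcal L(\tilde q,a,\gamma)$ coincide (with multiplicities), then $q=\tilde q$ a.e. on $(0,1)$. -/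

import Mathlib

open MeasureTheory Set

noncomputable section

namespace FrozenHill

/-! ### The boundary value problem
`-y'' + q(x) y(a) = lam y` on `(0,1)`, `y(0) = γ y(1)`, `y'(0) = γ y'(1)`. -/

/-- `y` belongs to the Sobolev space `W₂²[0,1]`, with first derivative `y'` and second derivative
`y''`: `y''` is square-integrable and `y'`, `y` are its successive primitives. -/
structure IsW22 (y y' y'' : ℝ → ℂ) : Prop where
  memLp : MemLp y'' 2 (volume.restrict (Ioo (0 : ℝ) 1))
  primitive_fst : ∀ x ∈ Icc (0 : ℝ) 1, y x = y 0 + ∫ t in (0 : ℝ)..x, y' t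
  primitive_snd : ∀ x ∈ Icc (0 : ℝ) 1, y' x = y' 0 + ∫ t in (0 : ℝ)..x, y'' t

/-- `y`, with derivative `y'`, is a `W₂²[0,1]`-solution of `-y''(x) + q(x) y(a) = lam y(x)`,
a.e. on `(0,1)`. -/
def IsSolution (q : ℝ → ℂ) (a : ℝ) (lam : ℂ) (y y' : ℝ → ℂ) : Prop :=
  ∃ y'' : ℝ → ℂ, IsW22 y y' y'' ∧
    ∀ᵐ x ∂(volume.restrict (Ioo (0 : ℝ) 1)), -y'' x + q x * y a = lam * y x

/-- `lam` is an eigenvalue of the problem `L(q, a, γ)`: there is a nontrivial solution satisfying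
the boundary conditions. -/
def IsEigenvalue (q : ℝ → ℂ) (a : ℝ) (γ lam : ℂ) : Prop :=
  ∃ y y' : ℝ → ℂ, IsSolution q a lam y y' ∧ y 0 = γ * y 1 ∧ y' 0 = γ * y' 1 ∧
    ∃ x ∈ Icc (0 : ℝ) 1, y x ≠ 0

/-! ### The characteristic function -/

/-- `ρ` with `ρ ^ 2 = lam`. The functions below do not depend on the choice of the root. -/
def rho (lam : ℂ) : ℂ := lam ^ (2⁻¹ : ℂ)

/-- `cos (ρ x)`. -/
def cosRho (lam : ℂ) (x : ℝ) : ℂ := Complex.cos (rho lam * x)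

/-- `sin (ρ x) / ρ`, understood as `x` for `ρ = 0`. -/
def sinRho (lam : ℂ) (x : ℝ) : ℂ :=
  if lam = 0 then (x : ℂ) else Complex.sin (rho lam * x) / rho lam

/-- The solution `C(x, lam)` with `C(a) = 1`, `C'(a) = 0` (see `solC_isSolution`). -/
def solC (q : ℝ → ℂ) (a : ℝ) (lam : ℂ) (x : ℝ) : ℂ :=
  cosRho lam (x - a) + ∫ t in a..x, sinRho lam (x - t) * q t

/-- The derivative `C'(x, lam)` in `x`. -/
def solC' (q : ℝ → ℂ) (a : ℝ) (lam : ℂ) (x : ℝ) : ℂ :=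
  -(lam * sinRho lam (x - a)) + ∫ t in a..x, cosRho lam (x - t) * q t

/-- The solution `S(x, lam)` with `S(a) = 0`, `S'(a) = 1` (see `solS_isSolution`). -/
def solS (a : ℝ) (lam : ℂ) (x : ℝ) : ℂ := sinRho lam (x - a)

/-- The derivative `S'(x, lam)` in `x`. -/
def solS' (a : ℝ) (lam : ℂ) (x : ℝ) : ℂ := cosRho lam (x - a)

/-- The characteristic function of `L(q, a, γ)`. -/
def characteristicFn (q : ℝ → ℂ) (a : ℝ) (γ lam : ℂ) : ℂ :=
  Matrix.det
    !![solC q a lam 0 - γ * solC q a lam 1, solS a lam 0 - γ * solS a lam 1;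
       solC' q a lam 0 - γ * solC' q a lam 1, solS' a lam 0 - γ * solS' a lam 1]

open scoped Classical in
/-- The spectrum of `L(q, a, γ)`, as a multiplicity function on `ℂ`: an eigenvalue is counted with
its algebraic multiplicity, the order of the zero of the characteristic function; other numbers are
counted zero times. -/
def spectrumMult (q : ℝ → ℂ) (a : ℝ) (γ lam : ℂ) : ℕ∞ :=
  if IsEigenvalue q a γ lam then analyticOrderAt (characteristicFn q a γ) lam else 0

/-! ### The condition for `γ = ±1` -/

/-- The function `q_a` on `(0,1)`. -/
def shiftPotential (q : ℝ → ℂ) (a : ℝ) (γ : ℂ) (x : ℝ) : ℂ :=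
  if x < 1 - a then q (x + a) else γ⁻¹ * q (x + a - 1)

/-- The complex Hilbert space `L₂(0, 1/2)`. -/
abbrev L2Half : Type := Lp ℂ 2 (volume.restrict (Ioo (0 : ℝ) (1 / 2)))

/-- `f(1/2 - x) = K(f(1/2 + x))` a.e. on `(0, 1/2)`; here `u` is the class of `x ↦ f(1/2 + x)` in
`L₂(0, 1/2)`. -/
def HalfRelation (K : L2Half → L2Half) (f : ℝ → ℂ) : Prop :=
  ∃ u : L2Half,
    (∀ᵐ x ∂(volume.restrict (Ioo (0 : ℝ) (1 / 2))), u x = f (1 / 2 + x)) ∧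
    ∀ᵐ x ∂(volume.restrict (Ioo (0 : ℝ) (1 / 2))), f (1 / 2 - x) = K u x

/-! ### `C` and `S` solve the equation -/

theorem rho_sq (lam : ℂ) : rho lam * rho lam = lam := by
  have h := Complex.cpow_nat_inv_pow lam (n := 2) (by norm_num)
  rw [rho, ← sq]
  exact_mod_cast h

theorem sinRho_zero (lam : ℂ) : sinRho lam 0 = 0 := by simp [sinRho]

theorem cosRho_zero (lam : ℂ) : cosRho lam 0 = 1 := by simp [cosRho]

theorem rho_ne (lam : ℂ) (h : lam ≠ 0) : rho lam ≠ 0 := by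
  intro h0
  apply h
  rw [← rho_sq lam, h0, zero_mul]

theorem sinRho_mul (lam : ℂ) (x : ℝ) : Complex.sin (rho lam * x) = rho lam * sinRho lam x := by
  by_cases h : lam = 0
  · subst h
    have : rho 0 = 0 := by simpa using rho_sq 0
    simp [this]
  · simp [sinRho, h, mul_div_cancel₀ _ (rho_ne lam h)]

theorem hasDerivAt_cosRho (lam : ℂ) (x : ℝ) :
    HasDerivAt (cosRho lam) (-(lam * sinRho lam x)) x := by
  have h1 : HasDerivAt (fun y : ℝ => rho lam * (y : ℂ)) (rho lam * 1) x :=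
    (Complex.ofRealCLM.hasDerivAt (x := x)).const_mul (rho lam)
  refine ((Complex.hasDerivAt_cos (rho lam * x)).comp x h1).congr_deriv ?_
  rw [sinRho_mul]
  linear_combination (-sinRho lam x) * rho_sq lam

theorem hasDerivAt_sinRho (lam : ℂ) (x : ℝ) :
    HasDerivAt (sinRho lam) (cosRho lam x) x := by
  by_cases h : lam = 0
  · subst h
    have h0 : rho 0 = 0 := by simpa using rho_sq 0
    have h1 : sinRho 0 = fun y : ℝ => (y : ℂ) := by funext y; simp [sinRho]
    have h2 : HasDerivAt (fun y : ℝ => (y : ℂ)) 1 x := Complex.ofRealCLM.hasDerivAt (x := x)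
    simpa [h1, cosRho, h0] using h2
  · have h1 : HasDerivAt (fun y : ℝ => rho lam * (y : ℂ)) (rho lam * 1) x :=
      (Complex.ofRealCLM.hasDerivAt (x := x)).const_mul (rho lam)
    have h2 := ((Complex.hasDerivAt_sin (rho lam * x)).comp x h1).div_const (rho lam)
    have h3 : sinRho lam = fun y : ℝ => Complex.sin (rho lam * y) / rho lam := by
      funext y; simp [sinRho, h]
    rw [h3]
    refine h2.congr_deriv ?_
    have := rho_ne lam h
    rw [cosRho]; field_simp

theorem continuous_cosRho (lam : ℂ) : Continuous (cosRho lam) :=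
  continuous_iff_continuousAt.2 fun x => (hasDerivAt_cosRho lam x).continuousAt

theorem continuous_sinRho (lam : ℂ) : Continuous (sinRho lam) :=
  continuous_iff_continuousAt.2 fun x => (hasDerivAt_sinRho lam x).continuousAt

theorem sinRho_sub (lam : ℂ) (x t : ℝ) :
    sinRho lam (x - t) = sinRho lam x * cosRho lam t - cosRho lam x * sinRho lam t := by
  by_cases h : lam = 0
  · subst h
    have h0 : rho 0 = 0 := by simpa using rho_sq 0
    simp [sinRho, cosRho, h0]
  · have := rho_ne lam h
    simp only [sinRho, h, if_false, cosRho]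
    push_cast
    rw [mul_sub, Complex.sin_sub]
    field_simp

theorem cosRho_sub (lam : ℂ) (x t : ℝ) :
    cosRho lam (x - t) = cosRho lam x * cosRho lam t + lam * (sinRho lam x * sinRho lam t) := by
  have e := rho_sq lam
  have h : cosRho lam (x - t) = cosRho lam x * cosRho lam t +
      Complex.sin (rho lam * x) * Complex.sin (rho lam * t) := by
    simp only [cosRho]
    push_cast
    rw [mul_sub, Complex.cos_sub]
  rw [h, sinRho_mul, sinRho_mul]
  linear_combination (sinRho lam x * sinRho lam t) * e

theorem ac_integral {f : ℝ → ℂ} (hf : IntervalIntegrable f volume 0 1) {c : ℝ}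
    (hc : c ∈ uIcc (0 : ℝ) 1) :
    AbsolutelyContinuousOnInterval (fun x => ∫ t in c..x, f t) 0 1 := by
  have hre : IntervalIntegrable (fun t => (f t).re) volume 0 1 := ⟨hf.1.re, hf.2.re⟩
  have him : IntervalIntegrable (fun t => (f t).im) volume 0 1 := ⟨hf.1.im, hf.2.im⟩
  have hconst (z : ℂ) : AbsolutelyContinuousOnInterval (fun _ : ℝ => z) 0 1 :=
    contDiff_const.contDiffOn.absolutelyContinuousOnInterval
  have h := ((hre.absolutelyContinuousOnInterval_intervalIntegral hc).fun_smul (hconst 1)).fun_add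
    ((him.absolutelyContinuousOnInterval_intervalIntegral hc).fun_smul (hconst Complex.I))
  have e : ∀ x ∈ uIcc (0 : ℝ) 1, (∫ t in c..x, (f t).re) • (1 : ℂ) +
      (∫ t in c..x, (f t).im) • Complex.I = ∫ t in c..x, f t := by
    intro x hx
    have hs : uIcc c x ⊆ uIcc 0 1 := uIcc_subset_uIcc hc hx
    rw [← intervalIntegral.integral_smul_const, ← intervalIntegral.integral_smul_const,
      ← intervalIntegral.integral_add]
    · refine intervalIntegral.integral_congr fun t _ => ?_
      simp [Complex.re_add_im]
    · exact ⟨(hre.mono_set hs).1.smul_const _, (hre.mono_set hs).2.smul_const _⟩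
    · exact ⟨(him.mono_set hs).1.smul_const _, (him.mono_set hs).2.smul_const _⟩
  rw [absolutelyContinuousOnInterval_iff] at h ⊢
  intro ε hε
  obtain ⟨δ, hδ, H⟩ := h ε hε
  refine ⟨δ, hδ, fun E hE hl => ?_⟩
  refine lt_of_eq_of_lt (Finset.sum_congr rfl fun i hi => ?_) (H E hE hl)
  have hm := hE.1 i hi
  simp only [e _ hm.1, e _ hm.2]

theorem eq_primitive {f f' : ℝ → ℂ} (hf : AbsolutelyContinuousOnInterval f 0 1)
    (hd : ∀ᵐ x : ℝ, x ∈ uIcc (0 : ℝ) 1 → HasDerivAt f (f' x) x)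
    (hi : IntervalIntegrable f' volume 0 1) (x : ℝ) (hx : x ∈ Icc (0 : ℝ) 1) :
    f x = f 0 + ∫ t in (0 : ℝ)..x, f' t := by
  have hac := ac_integral hi (c := 0) (by simp)
  obtain ⟨c, hc⟩ := (hf.fun_sub hac).const_of_ae_hasDerivAt_zero (by
    filter_upwards [hd, hi.ae_hasDerivAt_integral] with y h1 h2 hy
    exact ((h1 hy).sub (h2 hy 0 (by simp))).congr_deriv (sub_self _))
  have h0 := hc 0 (by simp)
  have h1 := hc x (by rwa [uIcc_of_le zero_le_one])
  simp only [intervalIntegral.integral_same, sub_zero] at h0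
  linear_combination h1 - h0

theorem ac_of_hasDerivAt {f f' : ℝ → ℂ} (h : ∀ x, HasDerivAt f (f' x) x) (hc : Continuous f') :
    AbsolutelyContinuousOnInterval f 0 1 := by
  have hd : deriv f = f' := funext fun x => (h x).deriv
  have : ContDiff ℝ 1 f := contDiff_one_iff_deriv.2 ⟨fun x => (h x).differentiableAt, hd ▸ hc⟩
  exact this.contDiffOn.absolutelyContinuousOnInterval

theorem intervalIntegrable_of_memLp {q : ℝ → ℂ}
    (hq : MemLp q 2 (volume.restrict (Ioo (0 : ℝ) 1))) : IntervalIntegrable q volume 0 1 := by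
  rw [intervalIntegrable_iff_integrableOn_Ioo_of_le zero_le_one]
  exact hq.integrable (by norm_num)

theorem solC_init (q : ℝ → ℂ) (a : ℝ) (lam : ℂ) : solC q a lam a = 1 ∧ solC' q a lam a = 0 := by
  simp [solC, solC', cosRho_zero, sinRho_zero]

theorem solS_init (a : ℝ) (lam : ℂ) : solS a lam a = 0 ∧ solS' a lam a = 1 := by
  simp [solS, solS', cosRho_zero, sinRho_zero]

theorem hasDerivAt_solS (a : ℝ) (lam : ℂ) (x : ℝ) :
    HasDerivAt (solS a lam) (solS' a lam x) x :=
  (hasDerivAt_sinRho lam (x - a)).comp_sub_const x a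

theorem hasDerivAt_solS' (a : ℝ) (lam : ℂ) (x : ℝ) :
    HasDerivAt (solS' a lam) (-(lam * solS a lam x)) x :=
  (hasDerivAt_cosRho lam (x - a)).comp_sub_const x a

theorem continuous_solS (a : ℝ) (lam : ℂ) : Continuous (solS a lam) :=
  continuous_iff_continuousAt.2 fun x => (hasDerivAt_solS a lam x).continuousAt

theorem continuous_solS' (a : ℝ) (lam : ℂ) : Continuous (solS' a lam) :=
  continuous_iff_continuousAt.2 fun x => (hasDerivAt_solS' a lam x).continuousAt

theorem memLp_of_continuousOn {f : ℝ → ℂ} (hf : ContinuousOn f (Icc 0 1)) :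
    MemLp f 2 (volume.restrict (Ioo (0 : ℝ) 1)) := by
  obtain ⟨M, hM⟩ := isCompact_Icc.exists_bound_of_continuousOn hf
  refine MemLp.of_bound ((hf.mono Ioo_subset_Icc_self).aestronglyMeasurable measurableSet_Ioo) M ?_
  filter_upwards [ae_restrict_mem measurableSet_Ioo] with x hx
  exact hM x (Ioo_subset_Icc_self hx)

/-- `S` is a solution of the equation. -/
theorem solS_isSolution (q : ℝ → ℂ) (a : ℝ) (lam : ℂ) :
    IsSolution q a lam (solS a lam) (solS' a lam) := by
  have hc : Continuous fun x => -(lam * solS a lam x) := ((continuous_solS a lam).const_mul lam).neg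
  refine ⟨fun x => -(lam * solS a lam x), ⟨memLp_of_continuousOn hc.continuousOn, ?_, ?_⟩, ?_⟩
  · exact eq_primitive (ac_of_hasDerivAt (hasDerivAt_solS a lam) (continuous_solS' a lam))
      (.of_forall fun x _ => hasDerivAt_solS a lam x)
      ((continuous_solS' a lam).intervalIntegrable _ _)
  · exact eq_primitive (ac_of_hasDerivAt (hasDerivAt_solS' a lam) hc)
      (.of_forall fun x _ => hasDerivAt_solS' a lam x) (hc.intervalIntegrable _ _)
  · refine .of_forall fun x => ?_
    simp [(solS_init a lam).1]

set_option maxHeartbeats 1000000 in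
/-- `C` is a solution of the equation. -/
theorem solC_isSolution {q : ℝ → ℂ} (hq : MemLp q 2 (volume.restrict (Ioo (0 : ℝ) 1))) {a : ℝ}
    (ha : a ∈ Icc (0 : ℝ) 1) (lam : ℂ) :
    IsSolution q a lam (solC q a lam) (solC' q a lam) := by
  have hqi := intervalIntegrable_of_memLp hq
  have hau : a ∈ uIcc (0 : ℝ) 1 := by rwa [uIcc_of_le zero_le_one]
  have hcs := continuous_cosRho lam
  have hsn := continuous_sinRho lam
  have hci : IntervalIntegrable (fun t => cosRho lam t * q t) volume 0 1 :=
    hqi.continuousOn_mul hcs.continuousOn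
  have hsi : IntervalIntegrable (fun t => sinRho lam t * q t) volume 0 1 :=
    hqi.continuousOn_mul hsn.continuousOn
  have hsub : ∀ x ∈ Icc (0 : ℝ) 1, uIcc a x ⊆ uIcc 0 1 := fun x hx =>
    uIcc_subset_uIcc hau (by rwa [uIcc_of_le zero_le_one])
  set Ic : ℝ → ℂ := fun x => ∫ t in a..x, cosRho lam t * q t with hIc
  set Is : ℝ → ℂ := fun x => ∫ t in a..x, sinRho lam t * q t with hIs
  set F : ℝ → ℂ := fun x => cosRho lam (x - a) + (sinRho lam x * Ic x - cosRho lam x * Is x) with hF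
  set G : ℝ → ℂ := fun x => -(lam * sinRho lam (x - a)) +
    (cosRho lam x * Ic x + lam * (sinRho lam x * Is x)) with hG
  have eF : ∀ x ∈ Icc (0 : ℝ) 1, solC q a lam x = F x := by
    intro x hx
    simp only [solC, hF, hIc, hIs, ← intervalIntegral.integral_const_mul]
    rw [← intervalIntegral.integral_sub ((hci.mono_set (hsub x hx)).const_mul _)
      ((hsi.mono_set (hsub x hx)).const_mul _)]
    congr 1
    refine intervalIntegral.integral_congr fun t _ => ?_
    simp only [sinRho_sub]; ring
  have eG : ∀ x ∈ Icc (0 : ℝ) 1, solC' q a lam x = G x := by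
    intro x hx
    simp only [solC', hG, hIc, hIs, ← intervalIntegral.integral_const_mul]
    rw [← intervalIntegral.integral_add ((hci.mono_set (hsub x hx)).const_mul _)
      (((hsi.mono_set (hsub x hx)).const_mul _).const_mul _)]
    congr 1
    refine intervalIntegral.integral_congr fun t _ => ?_
    simp only [cosRho_sub]; ring
  have acc := ac_of_hasDerivAt (hasDerivAt_cosRho lam) ((hsn.const_mul lam).neg)
  have acs := ac_of_hasDerivAt (hasDerivAt_sinRho lam) hcs
  have acIc : AbsolutelyContinuousOnInterval Ic 0 1 :=
    ac_integral hci hau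
  have acIs : AbsolutelyContinuousOnInterval Is 0 1 :=
    ac_integral hsi hau
  have acS : AbsolutelyContinuousOnInterval (fun x => sinRho lam (x - a)) 0 1 :=
    ac_of_hasDerivAt (hasDerivAt_solS a lam) (continuous_solS' a lam)
  have acC : AbsolutelyContinuousOnInterval (fun x => cosRho lam (x - a)) 0 1 :=
    ac_of_hasDerivAt (hasDerivAt_solS' a lam) (((continuous_solS a lam).const_mul lam).neg)
  have acF : AbsolutelyContinuousOnInterval F 0 1 :=
    acC.fun_add ((acs.fun_smul acIc).fun_sub (acc.fun_smul acIs))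
  have acG : AbsolutelyContinuousOnInterval G 0 1 :=
    (acS.const_smul lam).fun_neg.fun_add
      ((acc.fun_smul acIc).fun_add ((acs.fun_smul acIs).const_smul lam))
  have hqF : IntervalIntegrable (fun x => q x - lam * F x) volume 0 1 :=
    hqi.sub ((acF.continuousOn.intervalIntegrable).const_mul lam)
  have dF : ∀ᵐ x : ℝ, x ∈ uIcc (0 : ℝ) 1 → HasDerivAt F (G x) x := by
    filter_upwards [hci.ae_hasDerivAt_integral, hsi.ae_hasDerivAt_integral] with x h1 h2 hx
    have k := (hasDerivAt_solS' a lam x).add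
      (((hasDerivAt_sinRho lam x).mul (h1 hx a hau)).sub
        ((hasDerivAt_cosRho lam x).mul (h2 hx a hau)))
    refine k.congr_deriv ?_
    simp only [hG, hIc, hIs, solS]; ring
  have dG : ∀ᵐ x : ℝ, x ∈ uIcc (0 : ℝ) 1 → HasDerivAt G (q x - lam * F x) x := by
    filter_upwards [hci.ae_hasDerivAt_integral, hsi.ae_hasDerivAt_integral] with x h1 h2 hx
    have k := ((hasDerivAt_solS a lam x).const_mul lam).neg.add
      (((hasDerivAt_cosRho lam x).mul (h1 hx a hau)).add
        (((hasDerivAt_sinRho lam x).mul (h2 hx a hau)).const_mul lam))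
    refine k.congr_deriv ?_
    have e : cosRho lam x * cosRho lam x + lam * (sinRho lam x * sinRho lam x) = 1 := by
      rw [← cosRho_sub, sub_self, cosRho_zero]
    simp only [hF, hIc, hIs, solS']
    linear_combination q x * e
  have h0 : (0 : ℝ) ∈ Icc (0 : ℝ) 1 := by simp
  have hint : ∀ x ∈ Icc (0 : ℝ) 1, ∀ t ∈ uIcc 0 x, t ∈ Icc (0 : ℝ) 1 := by
    intro x hx t ht
    rw [uIcc_of_le hx.1] at ht
    exact ⟨ht.1, ht.2.trans hx.2⟩
  have hcF : ContinuousOn F (Icc 0 1) := by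
    simpa [uIcc_of_le zero_le_one] using acF.continuousOn
  refine ⟨fun x => q x - lam * F x, ⟨?_, ?_, ?_⟩, ?_⟩
  · exact hq.sub ((memLp_of_continuousOn hcF).const_mul lam)
  · intro x hx
    rw [eF x hx, eF 0 h0, eq_primitive acF dF acG.continuousOn.intervalIntegrable x hx,
      intervalIntegral.integral_congr fun t ht => (eG t (hint x hx t ht)).symm]
  · intro x hx
    rw [eG x hx, eG 0 h0]
    exact eq_primitive acG dG hqF x hx
  · filter_upwards [ae_restrict_mem measurableSet_Ioo] with x hx
    rw [(solC_init q a lam).1, eF x (Ioo_subset_Icc_self hx)]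
    ring

end FrozenHill

end

namespace FrozenHill

/-! Write `lam = ρ²` and `w(s) = γ q_a(s) + q_a(1 - s)`. Expanding the determinant with the addition
formulas gives `Δ = 1 + γ² - 2γ cos ρ - γ ∫₀¹ w(s) sin(ρs)/ρ ds` (`characteristicFn_eq`). The
spectrum therefore depends on `q` only through `w`, and the theorem splits into recovering `w` from
the zeros of `Δ` and `q` from `w`.

For the first half no factorization theorem is needed. Two such functions share the leading term `1
+ γ² - 2γ cos ρ`, which is at least a constant times `exp |Im ρ|` on a sequence of expanding squares
(`exists_squares`), while the integral terms are `O(exp |Im ρ| / |ρ|)`. If the zeros agree with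
orders, the relative difference of the two functions is entire and tends to zero on these squares,
so by the maximum principle it vanishes (`eq_of_order_eq_of_relative_difference`). Hence the sine
transforms of the two weights coincide, and completeness of the sines on `(0, 1)` gives equality of
the weights (`ae_eq_zero_of_sineTransform_eq_zero`).

For the second half, the values of `w` at `x` and `1 - x` form a linear system for `q_a(x)`, `q_a(1
- x)` with determinant `γ² - 1`. It is invertible unless `γ = ±1`; in that case `γ w(1/2 + x)`
equals `(I + γK)` applied to `q_a(1/2 + x)`, and injectivity finishes the argument. Finally `q_a` is
an invertible rearrangement of `q`. -/

/-! ### Even entire functions of `√lam`, and uniqueness from zeros. -/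

theorem even_apply_eq {E : ℂ → ℂ} (he : ∀ z, E (-z) = E z) {z w : ℂ} (h : z * z = w * w) :
    E z = E w := by
  rcases mul_self_eq_mul_self_iff.1 h with rfl | rfl
  · rfl
  · exact he w

/-- Since `‖rho l‖ = √‖l‖`, the branch point itself causes no discontinuity; this feeds the
removable singularity argument at the origin. -/
theorem continuousAt_rho_zero : ContinuousAt rho 0 := by
  have h0 : rho 0 = 0 := by simpa using rho_sq 0
  rw [ContinuousAt, h0, tendsto_zero_iff_norm_tendsto_zero]
  have h : ∀ l : ℂ, ‖rho l‖ = Real.sqrt ‖l‖ := by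
    intro l
    rw [eq_comm, Real.sqrt_eq_iff_mul_self_eq (norm_nonneg _) (norm_nonneg _), ← norm_mul, rho_sq]
  simp only [h]
  have : Continuous fun l : ℂ => Real.sqrt ‖l‖ := by fun_prop
  simpa using this.tendsto 0

theorem differentiableAt_rho {l : ℂ} (hl : l ∈ Complex.slitPlane) : DifferentiableAt ℂ rho l := by
  unfold rho
  exact differentiableAt_id.cpow_const hl

/-- An even entire function of `√lam` is an entire function of `lam`. -/
theorem differentiable_even_comp_rho {E : ℂ → ℂ} (hE : Differentiable ℂ E)
    (he : ∀ z, E (-z) = E z) : Differentiable ℂ fun l => E (rho l) := by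
  have hne : ∀ l : ℂ, l ≠ 0 → DifferentiableAt ℂ (fun l => E (rho l)) l := by
    intro l hl
    rcases Complex.mem_slitPlane_or_neg_mem_slitPlane hl with h | h
    · exact (hE _).comp l (differentiableAt_rho h)
    · have e : (fun l => E (rho l)) = fun l => E (Complex.I * rho (-l)) := by
        funext m
        apply even_apply_eq he
        linear_combination rho_sq m + rho_sq (-m) - (rho (-m) * rho (-m)) * Complex.I_mul_I
      rw [e]
      have h1 : DifferentiableAt ℂ (fun l => rho (-l)) l :=
        DifferentiableAt.comp l (f := fun l : ℂ => -l) (g := rho) (differentiableAt_rho h)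
          differentiableAt_id.neg
      exact DifferentiableAt.comp l (g := E) (hE _) (h1.const_mul Complex.I)
  -- Removable singularity at `0`: differentiability elsewhere together with continuity there is
  -- enough.
  rw [← differentiableOn_univ, ← Complex.differentiableOn_compl_singleton_and_continuousAt_iff
    (c := 0) Filter.univ_mem]
  exact ⟨fun l hl => (hne l (by simpa using hl)).differentiableWithinAt,
    ContinuousAt.comp (g := E) (hE _).continuousAt continuousAt_rho_zero⟩

/-- If two entire functions have the same zeros, the relative difference extends to an entire
function. -/
theorem exists_entire_relative_difference {f g : ℂ → ℂ} (hf : Differentiable ℂ f)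
    (hg : Differentiable ℂ g) (ho : ∀ z, analyticOrderAt f z = analyticOrderAt g z) :
    ∃ h : ℂ → ℂ, Differentiable ℂ h ∧ ∀ z, g z ≠ 0 → h z = (f z - g z) / g z := by
  have hfa : ∀ z, AnalyticAt ℂ f z := fun z => hf.analyticAt z
  have hga : ∀ z, AnalyticAt ℂ g z := fun z => hg.analyticAt z
  set k : ℂ → ℂ := (f - g) / g with hk
  have hkm : MeromorphicOn k univ := fun z _ =>
    ((hfa z).meromorphicAt.sub (hga z).meromorphicAt).div (hga z).meromorphicAt
  have hnf : ∀ z, MeromorphicNFAt (toMeromorphicNFOn k univ) z := fun z =>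
    meromorphicNFOn_toMeromorphicNFOn k univ (mem_univ z)
  refine ⟨toMeromorphicNFOn k univ, fun z => ?_, fun z hz => ?_⟩
  · refine AnalyticAt.differentiableAt ((hnf z).meromorphicOrderAt_nonneg_iff_analyticAt.1 ?_)
    rw [meromorphicOrderAt_toMeromorphicNFOn hkm (mem_univ z), hk,
      meromorphicOrderAt_div ((hfa z).sub (hga z)).meromorphicAt (hga z).meromorphicAt,
      ((hfa z).sub (hga z)).meromorphicOrderAt_eq, (hga z).meromorphicOrderAt_eq]
    -- The order of a difference is at least the minimum of the two orders, which are equal here; so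
    -- the quotient has no pole.
    have h1 : analyticOrderAt g z ≤ analyticOrderAt (f - g) z := by
      refine le_trans ?_ (le_analyticOrderAt_sub (f := f) (g := g) (z₀ := z))
      simp [ho z]
    generalize analyticOrderAt (f - g) z = m at h1
    generalize analyticOrderAt g z = n at h1
    cases n with
    | top => simp_all
    | coe n =>
      cases m with
      | top => simp
      | coe m =>
        have : n ≤ m := by exact_mod_cast h1
        simp only [ENat.map_natCast]
        rw [← WithTop.LinearOrderedAddCommGroup.coe_sub]
        exact_mod_cast sub_nonneg.2 (by exact_mod_cast this : (n : ℤ) ≤ m)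
  · have hka : AnalyticAt ℂ k z := ((hfa z).sub (hga z)).div (hga z) hz
    have e := hkm.toMeromorphicNFOn_eq_self_on_nhdsNE (mem_univ z)
    -- Both functions are in normal form at `z`, so agreement on a punctured neighbourhood extends
    -- to `z` itself.
    have e2 := ((hka.meromorphicNFAt).eventuallyEq_nhdsNE_iff_eventuallyEq_nhds (hnf z)).1 e.symm
    exact e2.eq_of_nhds.symm

/-- The maximum principle on the square of half side `R`. -/
theorem norm_le_of_square_boundary {h : ℂ → ℂ} (hh : Differentiable ℂ h) {R C : ℝ}
    (hb : ∀ z : ℂ, |z.re| ≤ R → |z.im| ≤ R → (|z.re| = R ∨ |z.im| = R) → ‖h z‖ ≤ C)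
    {z : ℂ} (h1 : |z.re| < R) (h2 : |z.im| < R) : ‖h z‖ ≤ C := by
  set U : Set ℂ := {z | |z.re| < R ∧ |z.im| < R} with hU
  have hc1 : Continuous fun z : ℂ => |z.re| := Complex.continuous_re.abs
  have hc2 : Continuous fun z : ℂ => |z.im| := Complex.continuous_im.abs
  have hUo : IsOpen U := (isOpen_lt hc1 continuous_const).inter (isOpen_lt hc2 continuous_const)
  have hUb : Bornology.IsBounded U := by
    refine (Metric.isBounded_iff_subset_closedBall 0).2 ⟨2 * R, fun w hw => ?_⟩
    rw [mem_closedBall_zero_iff]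
    linarith [Complex.norm_le_abs_re_add_abs_im w, hw.1, hw.2]
  have hcl : closure U ⊆ {z | |z.re| ≤ R ∧ |z.im| ≤ R} :=
    closure_minimal (fun w hw => ⟨hw.1.le, hw.2.le⟩)
      ((isClosed_le hc1 continuous_const).inter (isClosed_le hc2 continuous_const))
  refine Complex.norm_le_of_forall_mem_frontier_norm_le hUb hh.diffContOnCl (fun w hw => ?_)
    (subset_closure (show z ∈ U from ⟨h1, h2⟩))
  have hw1 := hcl (frontier_subset_closure hw)
  refine hb w hw1.1 hw1.2 ?_
  by_contra hcon
  push Not at hcon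
  rw [hUo.frontier_eq] at hw
  exact hw.2 ⟨lt_of_le_of_ne hw1.1 hcon.1, lt_of_le_of_ne hw1.2 hcon.2⟩

/-- Two entire functions with the same zeros coincide if, in the variable `ρ = √lam`, their
relative difference tends to zero on a sequence of expanding squares. -/
theorem eq_of_order_eq_of_relative_difference {f g : ℂ → ℂ} (hf : Differentiable ℂ f)
    (hg : Differentiable ℂ g) (ho : ∀ z, analyticOrderAt f z = analyticOrderAt g z)
    {R ε : ℕ → ℝ} (hR : Filter.Tendsto R Filter.atTop Filter.atTop)
    (hε : Filter.Tendsto ε Filter.atTop (nhds 0))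
    (hb : ∀ᶠ n in Filter.atTop, ∀ z : ℂ, |z.re| ≤ R n → |z.im| ≤ R n →
      (|z.re| = R n ∨ |z.im| = R n) →
      g (z * z) ≠ 0 ∧ ‖f (z * z) - g (z * z)‖ ≤ ε n * ‖g (z * z)‖) :
    f = g := by
  obtain ⟨h, hh, he⟩ := exists_entire_relative_difference hf hg ho
  have hz : ∀ z : ℂ, h z = 0 := by
    intro l
    -- The maximum principle is applied in the variable `ρ`, where the squares live.
    have hd : Differentiable ℂ fun z => h (z * z) := hh.comp (differentiable_id.mul differentiable_id)
    have hle : ∀ᶠ n in Filter.atTop, ‖h l‖ ≤ ε n := by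
      filter_upwards [hb, hR.eventually_gt_atTop |(rho l).re|, hR.eventually_gt_atTop |(rho l).im|]
        with n hn h1 h2
      have := norm_le_of_square_boundary hd (C := ε n) (fun z hz1 hz2 hz3 => ?_) h1 h2
      · simpa only [rho_sq] using this
      · obtain ⟨hne, hle⟩ := hn z hz1 hz2 hz3
        simp only [he _ hne, norm_div]
        rwa [div_le_iff₀ (norm_pos_iff.2 hne)]
    exact norm_le_zero_iff.1 (ge_of_tendsto hε hle)
  -- The vanishing of `h` gives `f = g` only where `g ≠ 0`. The real point `R n` lies on the
  -- boundary of a square, so `g` is nonzero near its square, and the identity theorem does the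
  -- rest.
  obtain ⟨n, hn, hRn⟩ := (hb.and (hR.eventually_ge_atTop 0)).exists
  obtain ⟨hne, -⟩ := hn (R n : ℂ) (by simp [abs_of_nonneg hRn]) (by simpa using hRn)
    (Or.inl (by simp [abs_of_nonneg hRn]))
  have hgc : ∀ᶠ z in nhds ((R n : ℂ) * R n), g z ≠ 0 :=
    hg.continuous.continuousAt.eventually_ne hne
  refine AnalyticOnNhd.eq_of_eventuallyEq (z₀ := (R n : ℂ) * R n) (fun z _ => hf.analyticAt z)
    (fun z _ => hg.analyticAt z) ?_
  filter_upwards [hgc] with z hzz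
  have := he z hzz
  rw [hz, eq_comm, div_eq_zero_iff] at this
  exact sub_eq_zero.1 (this.resolve_right hzz)

/-! ### Lower bounds for `1 + γ² - 2γ cos ρ` on expanding squares. -/

theorem norm_exp_I_mul (z : ℂ) : ‖Complex.exp (Complex.I * z)‖ = Real.exp (-z.im) := by
  simp [Complex.norm_exp]

/-- The factorization reflects `exp (iz) exp (-iz) = 1`; it reduces lower bounds to the two factors
separately. -/
theorem one_add_sq_sub_cos (γ z : ℂ) : 1 + γ ^ 2 - 2 * γ * Complex.cos z =
    (1 - γ * Complex.exp (Complex.I * z)) * (1 - γ * Complex.exp (Complex.I * -z)) := by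
  have h : Complex.exp (Complex.I * z) * Complex.exp (Complex.I * -z) = 1 := by
    rw [← Complex.exp_add]; simp
  rw [Complex.cos]
  have e1 : z * Complex.I = Complex.I * z := by ring
  have e2 : -z * Complex.I = Complex.I * -z := by ring
  rw [e1, e2]
  linear_combination (-γ ^ 2) * h

/-- The lower bound where `γ exp (iz)` and `γ exp (-iz)` have nonpositive real parts. -/
theorem le_norm_of_re_nonpos {γ z : ℂ} (h1 : (γ * Complex.exp (Complex.I * z)).re ≤ 0)
    (h2 : (γ * Complex.exp (Complex.I * -z)).re ≤ 0) :
    ‖γ‖ * Real.exp |z.im| ≤ ‖1 + γ ^ 2 - 2 * γ * Complex.cos z‖ := by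
  -- A point `u` of the closed left half-plane is at distance at least `max 1 ‖u‖` from `1`. Below,
  -- the growing exponential uses the second bound and the decaying one the first.
  have key : ∀ u : ℂ, u.re ≤ 0 → 1 ≤ ‖1 - u‖ ∧ ‖u‖ ≤ ‖1 - u‖ := by
    intro u hu
    constructor
    · refine le_trans ?_ (Complex.re_le_norm _)
      simp; linarith
    · rw [Complex.norm_eq_sqrt_sq_add_sq, Complex.norm_eq_sqrt_sq_add_sq]
      apply Real.sqrt_le_sqrt
      simp only [Complex.sub_re, Complex.one_re, Complex.sub_im, Complex.one_im]
      nlinarith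
  obtain ⟨a1, a2⟩ := key _ h1
  obtain ⟨b1, b2⟩ := key _ h2
  rw [norm_mul, norm_exp_I_mul] at a2 b2
  rw [one_add_sq_sub_cos, norm_mul]
  have hg := norm_nonneg γ
  rcases le_total 0 z.im with h | h
  · rw [abs_of_nonneg h]
    simp only [Complex.neg_im, neg_neg] at b2
    exact b2.trans (le_mul_of_one_le_left (norm_nonneg _) a1)
  · rw [abs_of_nonpos h]
    exact a2.trans (le_mul_of_one_le_right (norm_nonneg _) b1)

/-- The lower bound far from the real axis. -/
theorem le_norm_of_large_im {γ z : ℂ} (h1 : 2 ≤ ‖γ‖ * Real.exp |z.im|)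
    (h2 : 2 * ‖γ‖ ≤ Real.exp |z.im|) :
    ‖γ‖ / 4 * Real.exp |z.im| ≤ ‖1 + γ ^ 2 - 2 * γ * Complex.cos z‖ := by
  have key : ∀ z : ℂ, 0 ≤ z.im → 2 ≤ ‖γ‖ * Real.exp |z.im| → 2 * ‖γ‖ ≤ Real.exp |z.im| →
      ‖γ‖ / 4 * Real.exp |z.im| ≤
        ‖1 - γ * Complex.exp (Complex.I * z)‖ * ‖1 - γ * Complex.exp (Complex.I * -z)‖ := by
    intro z hz h1 h2
    rw [abs_of_nonneg hz] at *
    have a : 1 / 2 ≤ ‖1 - γ * Complex.exp (Complex.I * z)‖ := by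
      have := norm_sub_norm_le (1 : ℂ) (γ * Complex.exp (Complex.I * z))
      rw [norm_mul, norm_exp_I_mul, norm_one, Real.exp_neg] at this
      have e : ‖γ‖ * (Real.exp z.im)⁻¹ ≤ 1 / 2 := by
        rw [← div_eq_mul_inv, div_le_iff₀ (Real.exp_pos _)]; linarith
      linarith
    have b : ‖γ‖ * Real.exp z.im / 2 ≤ ‖1 - γ * Complex.exp (Complex.I * -z)‖ := by
      have := norm_sub_norm_le (γ * Complex.exp (Complex.I * -z)) (1 : ℂ)
      rw [norm_mul, norm_exp_I_mul, norm_one, norm_sub_rev] at this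
      simp only [Complex.neg_im, neg_neg] at this
      linarith
    have h0 : 0 ≤ ‖γ‖ * Real.exp z.im / 2 := by positivity
    nlinarith [mul_le_mul a b h0 (by positivity)]
  rw [one_add_sq_sub_cos, norm_mul]
  rcases le_total 0 z.im with h | h
  · exact key z h h1 h2
  · have := key (-z) (by simpa using h) (by simpa using h1) (by simpa using h2)
    rw [neg_neg, mul_comm (‖_‖)] at this
    simpa using this

/-- On the squares of half sides `R n`, the function `1 + γ² - 2γ cos ρ` is bounded below by
`exp |Im ρ|`. -/
theorem exists_squares (γ : ℂ) (hγ : γ ≠ 0) :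
    ∃ R : ℕ → ℝ, Filter.Tendsto R Filter.atTop Filter.atTop ∧
      ∀ᶠ n in Filter.atTop, ∀ z : ℂ, |z.re| ≤ R n → |z.im| ≤ R n →
      (|z.re| = R n ∨ |z.im| = R n) →
      ‖γ‖ / 4 * Real.exp |z.im| ≤ ‖1 + γ ^ 2 - 2 * γ * Complex.cos z‖ := by
  have hg : 0 < ‖γ‖ := norm_pos_iff.2 hγ
  -- `φ` is `0` or `π`, chosen so that `cos φ = ±1` opposes the sign of `Re γ`. On the vertical
  -- sides, where `Re z = ±(φ + 2πn)`, both `γ exp (iz)` and `γ exp (-iz)` then have nonpositive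
  -- real part, so the sides avoid the zeros.
  obtain ⟨φ, hs, hc⟩ : ∃ φ : ℝ, Real.sin φ = 0 ∧ Real.cos φ * γ.re ≤ 0 := by
    rcases le_total γ.re 0 with h | h
    · exact ⟨0, by simp, by simpa using h⟩
    · exact ⟨Real.pi, by simp, by simpa using h⟩
  have hR : Filter.Tendsto (fun n : ℕ => φ + n * (2 * Real.pi)) Filter.atTop Filter.atTop :=
    Filter.tendsto_atTop_add_const_left _ _
      (tendsto_natCast_atTop_atTop.atTop_mul_const (by positivity))
  refine ⟨fun n => φ + n * (2 * Real.pi), hR, ?_⟩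
  have hexp := Real.tendsto_exp_atTop.comp hR
  filter_upwards [hexp.eventually_ge_atTop (2 / ‖γ‖), hexp.eventually_ge_atTop (2 * ‖γ‖)]
    with n hn1 hn2 z _ _ hz
  rcases hz with hz | hz
  · have hcos : Real.cos z.re = Real.cos φ := by
      rw [← Real.cos_abs, hz, Real.cos_add_nat_mul_two_pi]
    have hsin : Real.sin z.re = 0 := by
      have := Real.sin_sq_add_cos_sq z.re
      rw [hcos] at this
      have h3 := Real.sin_sq_add_cos_sq φ
      rw [hs] at h3
      nlinarith
    refine le_trans ?_ (le_norm_of_re_nonpos ?_ ?_)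
    · nlinarith [Real.exp_pos |z.im|]
    · simp [Complex.exp_re, Complex.exp_im, hcos, hsin]
      nlinarith [Real.exp_pos (-z.im)]
    · simp [Complex.exp_re, Complex.exp_im, hcos, hsin]
      nlinarith [Real.exp_pos (z.im)]
  · refine le_norm_of_large_im ?_ ?_
    · rw [hz]
      rwa [div_le_iff₀ hg, mul_comm] at hn1
    · rw [hz]; exact hn2

/-! ### The sine transform and its recovery from the zeros. -/

theorem norm_sin_le (z : ℂ) : ‖Complex.sin z‖ ≤ Real.exp |z.im| := by
  have h1 : ‖Complex.exp (-z * Complex.I)‖ ≤ Real.exp |z.im| := by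
    rw [Complex.norm_exp]; apply Real.exp_le_exp.2; simpa using le_abs_self _
  have h2 : ‖Complex.exp (z * Complex.I)‖ ≤ Real.exp |z.im| := by
    rw [Complex.norm_exp]; apply Real.exp_le_exp.2; simpa using neg_le_abs _
  rw [Complex.sin, norm_div, norm_mul, Complex.norm_I, mul_one]
  have := norm_sub_le (Complex.exp (-z * Complex.I)) (Complex.exp (z * Complex.I))
  rw [show ‖(2 : ℂ)‖ = 2 by simp]
  linarith

theorem norm_cos_le (z : ℂ) : ‖Complex.cos z‖ ≤ Real.exp |z.im| := by
  have h1 : ‖Complex.exp (-z * Complex.I)‖ ≤ Real.exp |z.im| := by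
    rw [Complex.norm_exp]; apply Real.exp_le_exp.2; simpa using le_abs_self _
  have h2 : ‖Complex.exp (z * Complex.I)‖ ≤ Real.exp |z.im| := by
    rw [Complex.norm_exp]; apply Real.exp_le_exp.2; simpa using neg_le_abs _
  rw [Complex.cos, norm_div]
  have := norm_add_le (Complex.exp (z * Complex.I)) (Complex.exp (-z * Complex.I))
  rw [show ‖(2 : ℂ)‖ = 2 by simp]
  linarith

/-- The sine transform of `w` on `(0, 1)`. -/
noncomputable def sineTransform (w : ℝ → ℂ) (z : ℂ) : ℂ :=
  ∫ s in (0 : ℝ)..1, w s * Complex.sin (z * s)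

theorem hasDerivAt_sineTransform {w : ℝ → ℂ} (hw : IntervalIntegrable w volume 0 1) (z : ℂ) :
    HasDerivAt (sineTransform w) (∫ s in (0 : ℝ)..1, w s * (s * Complex.cos (z * s))) z := by
  have hm : AEStronglyMeasurable w (volume.restrict (uIoc (0 : ℝ) 1)) :=
    hw.def'.aestronglyMeasurable
  refine (intervalIntegral.hasDerivAt_integral_of_dominated_loc_of_deriv_le
    (F := fun z s => w s * Complex.sin (z * (s : ℝ)))
    (F' := fun z s => w s * (s * Complex.cos (z * (s : ℝ))))
    -- For `y` in the unit ball about `z` and `0 < s ≤ 1`, `|Im (ys)| ≤ ‖z‖ + 1`.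
    (bound := fun s => ‖w s‖ * Real.exp (‖z‖ + 1))
    (Metric.ball_mem_nhds z one_pos) ?_ ?_ ?_ ?_ ?_ ?_).2
  · refine .of_forall fun y => hm.mul (Continuous.aestronglyMeasurable ?_)
    fun_prop
  · exact hw.mul_continuousOn (by fun_prop)
  · exact hm.mul (Continuous.aestronglyMeasurable (by fun_prop))
  · refine .of_forall fun s hs y hy => ?_
    rw [uIoc_of_le zero_le_one] at hs
    have hy' : ‖y‖ ≤ ‖z‖ + 1 := by
      have := norm_le_norm_add_norm_sub' y z
      rw [Metric.mem_ball, dist_eq_norm] at hy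
      linarith
    rw [norm_mul, norm_mul]
    refine mul_le_mul_of_nonneg_left ?_ (norm_nonneg _)
    have h1 : ‖(s : ℂ)‖ ≤ 1 := by
      rw [Complex.norm_real, Real.norm_of_nonneg hs.1.le]; exact hs.2
    have h2 : ‖Complex.cos (y * s)‖ ≤ Real.exp (‖z‖ + 1) := by
      refine (norm_cos_le _).trans (Real.exp_le_exp.2 ?_)
      refine (Complex.abs_im_le_norm _).trans ?_
      rw [norm_mul]
      nlinarith [norm_nonneg y, norm_nonneg (s : ℂ)]
    calc ‖(s : ℂ)‖ * ‖Complex.cos (y * s)‖ ≤ 1 * Real.exp (‖z‖ + 1) :=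
          mul_le_mul h1 h2 (norm_nonneg _) zero_le_one
      _ = _ := one_mul _
  · exact hw.norm.mul_const _
  · refine .of_forall fun s _ y _ => ?_
    have h1 : HasDerivAt (fun y : ℂ => y * (s : ℂ)) (s : ℂ) y := hasDerivAt_mul_const _
    refine (((Complex.hasDerivAt_sin (y * s)).comp y h1).const_mul (w s)).congr_deriv ?_
    ring

theorem sineTransform_zero (w : ℝ → ℂ) : sineTransform w 0 = 0 := by simp [sineTransform]

theorem sineTransform_neg (w : ℝ → ℂ) (z : ℂ) : sineTransform w (-z) = -sineTransform w z := by
  simp [sineTransform]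

theorem norm_sineTransform_le {w : ℝ → ℂ} (hw : IntervalIntegrable w volume 0 1) (z : ℂ) :
    ‖sineTransform w z‖ ≤ (∫ s in (0 : ℝ)..1, ‖w s‖) * Real.exp |z.im| := by
  rw [← intervalIntegral.integral_mul_const]
  refine intervalIntegral.norm_integral_le_of_norm_le zero_le_one ?_ (hw.norm.mul_const _)
  refine .of_forall fun s hs => ?_
  rw [norm_mul]
  refine mul_le_mul_of_nonneg_left ((norm_sin_le _).trans (Real.exp_le_exp.2 ?_)) (norm_nonneg _)
  have : (z * s).im = z.im * s := by simp
  rw [this, abs_mul, abs_of_pos hs.1]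
  exact mul_le_of_le_one_right (abs_nonneg _) hs.2

/-- The characteristic function in the variable `ρ = √lam`, in terms of `w`. -/
noncomputable def charRho (γ : ℂ) (w : ℝ → ℂ) (z : ℂ) : ℂ :=
  1 + γ ^ 2 - 2 * γ * Complex.cos z - γ * dslope (sineTransform w) 0 z

theorem dslope_sineTransform_of_ne (w : ℝ → ℂ) {z : ℂ} (hz : z ≠ 0) :
    dslope (sineTransform w) 0 z = sineTransform w z / z := by
  rw [dslope_of_ne _ hz, slope_def_field, sineTransform_zero, sub_zero, sub_zero]

theorem charRho_neg (γ : ℂ) (w : ℝ → ℂ) (z : ℂ) : charRho γ w (-z) = charRho γ w z := by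
  rcases eq_or_ne z 0 with rfl | hz
  · simp
  · rw [charRho, charRho, dslope_sineTransform_of_ne w hz,
      dslope_sineTransform_of_ne w (neg_ne_zero.2 hz), sineTransform_neg, neg_div_neg_eq,
      Complex.cos_neg]

theorem differentiable_charRho (γ : ℂ) {w : ℝ → ℂ} (hw : IntervalIntegrable w volume 0 1) :
    Differentiable ℂ (charRho γ w) := by
  have h1 : Differentiable ℂ (sineTransform w) := fun z =>
    (hasDerivAt_sineTransform hw z).differentiableAt
  have h2 : Differentiable ℂ (dslope (sineTransform w) 0) := by
    rw [← differentiableOn_univ] at h1 ⊢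
    exact (Complex.differentiableOn_dslope Filter.univ_mem).2 h1
  unfold charRho
  exact (((differentiable_const _).sub (Complex.differentiable_cos.const_mul _))).sub
    (h2.const_mul _)

/-- The `dslope` at `0` encodes division by `ρ`; its value at `ρ = 0` is the derivative `∫ s w(s)
ds`, in accordance with the convention for `sinRho 0`. -/
theorem charRho_rho (γ : ℂ) {w : ℝ → ℂ} (hw : IntervalIntegrable w volume 0 1) (lam : ℂ) :
    charRho γ w (rho lam) = 1 + γ ^ 2 - 2 * γ * cosRho lam 1 -
      γ * ∫ s in (0 : ℝ)..1, w s * sinRho lam s := by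
  have key : dslope (sineTransform w) 0 (rho lam) = ∫ s in (0 : ℝ)..1, w s * sinRho lam s := by
    rcases eq_or_ne lam 0 with rfl | h
    · have h0 : rho 0 = 0 := by simpa using rho_sq 0
      rw [h0, dslope_same, (hasDerivAt_sineTransform hw 0).deriv]
      simp [sinRho]
    · rw [dslope_sineTransform_of_ne w (rho_ne lam h), sineTransform,
        ← intervalIntegral.integral_div]
      simp only [sinRho, h, if_false, mul_div_assoc]
  rw [charRho, key, cosRho]
  simp

/-- The orders of the zeros of the characteristic function determine the sine transform. -/
theorem sineTransform_eq_of_order_eq {γ : ℂ} (hγ : γ ≠ 0) {v w : ℝ → ℂ}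
    (hv : IntervalIntegrable v volume 0 1) (hw : IntervalIntegrable w volume 0 1)
    (ho : ∀ l, analyticOrderAt (fun l => charRho γ v (rho l)) l =
      analyticOrderAt (fun l => charRho γ w (rho l)) l) (z : ℂ) :
    sineTransform v z = sineTransform w z := by
  have hg : 0 < ‖γ‖ := norm_pos_iff.2 hγ
  obtain ⟨R, hR, hb⟩ := exists_squares γ hγ
  set A := ∫ s in (0 : ℝ)..1, ‖v s‖ with hA
  set B := ∫ s in (0 : ℝ)..1, ‖w s‖ with hB
  have hsq : ∀ (u : ℝ → ℂ) (z : ℂ), charRho γ u (rho (z * z)) = charRho γ u z := fun u z =>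
    even_apply_eq (charRho_neg γ u) (rho_sq _)
  -- Once `R n ≥ 8B`, the integral term takes away at most half of the lower bound `‖γ‖ e / 4`. The
  -- difference is at most `‖γ‖ (A + B) e / R n`, and dividing by the remaining `‖γ‖ e / 8` yields
  -- this `ε`.
  have heq := eq_of_order_eq_of_relative_difference (R := R) (ε := fun n => 8 * (A + B) / R n)
    (differentiable_even_comp_rho (differentiable_charRho γ hv) (charRho_neg γ v))
    (differentiable_even_comp_rho (differentiable_charRho γ hw) (charRho_neg γ w)) ho hR
    (hR.const_div_atTop _) (by
      filter_upwards [hb, hR.eventually_ge_atTop (8 * B), hR.eventually_gt_atTop 0]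
        with n hn hnB hn0 z hz1 hz2 hz3
      have hzR : R n ≤ ‖z‖ := by
        rcases hz3 with h | h
        · exact h ▸ Complex.abs_re_le_norm z
        · exact h ▸ Complex.abs_im_le_norm z
      have hz0 : z ≠ 0 := norm_pos_iff.1 (hn0.trans_le hzR)
      have hbound : ∀ {u : ℝ → ℂ}, IntervalIntegrable u volume 0 1 →
          ‖sineTransform u z / z‖ ≤ (∫ s in (0 : ℝ)..1, ‖u s‖) * Real.exp |z.im| / R n := by
        intro u hu
        rw [norm_div]
        exact div_le_div₀ (mul_nonneg (intervalIntegral.integral_nonneg zero_le_one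
          fun _ _ => norm_nonneg _) (Real.exp_pos _).le) (norm_sineTransform_le hu z) hn0 hzR
      have hbv := hbound hv
      have hbw := hbound hw
      rw [← hA] at hbv
      rw [← hB] at hbw
      simp only [hsq]
      simp only [charRho, dslope_sineTransform_of_ne _ hz0]
      set D := 1 + γ ^ 2 - 2 * γ * Complex.cos z
      set e := Real.exp |z.im| with he
      have hepos : 0 < e := Real.exp_pos _
      have hD : ‖γ‖ / 4 * e ≤ ‖D‖ := hn z hz1 hz2 hz3
      have hbw' : ‖sineTransform w z / z‖ ≤ e / 8 := by
        refine hbw.trans ?_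
        rw [div_le_iff₀ hn0]
        nlinarith
      have hlow : ‖γ‖ / 8 * e ≤ ‖D - γ * (sineTransform w z / z)‖ := by
        have := norm_sub_norm_le D (γ * (sineTransform w z / z))
        rw [norm_mul] at this
        nlinarith
      have hpos : 0 < ‖γ‖ / 8 * e := by positivity
      refine ⟨norm_pos_iff.1 (hpos.trans_le hlow), ?_⟩
      have h1 : ‖D - γ * (sineTransform v z / z) - (D - γ * (sineTransform w z / z))‖ ≤
          ‖γ‖ * ((A + B) * e / R n) := by
        rw [show D - γ * (sineTransform v z / z) - (D - γ * (sineTransform w z / z)) =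
          γ * (sineTransform w z / z - sineTransform v z / z) by ring, norm_mul]
        refine mul_le_mul_of_nonneg_left ?_ hg.le
        refine (norm_sub_le _ _).trans ((add_le_add hbw hbv).trans_eq ?_)
        ring
      have hAB : 0 ≤ 8 * (A + B) / R n := by
        have hA0 : 0 ≤ A := intervalIntegral.integral_nonneg zero_le_one fun _ _ => norm_nonneg _
        have hB0 : 0 ≤ B := intervalIntegral.integral_nonneg zero_le_one fun _ _ => norm_nonneg _
        positivity
      refine h1.trans (le_trans (le_of_eq ?_) (mul_le_mul_of_nonneg_left hlow hAB))
      ring)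
  rcases eq_or_ne z 0 with rfl | hz
  · rw [sineTransform_zero, sineTransform_zero]
  · have h := congrFun heq (z * z)
    simp only [hsq] at h
    simp only [charRho, dslope_sineTransform_of_ne _ hz] at h
    have h2 : γ * (sineTransform v z / z) = γ * (sineTransform w z / z) := by linear_combination -h
    exact (div_left_inj' hz).1 (mul_left_cancel₀ hγ h2)

/-! ### Completeness of the sine system. -/

theorem memLp_indicator {w : ℝ → ℂ} (hw : MemLp w 2 (volume.restrict (Ioo (0 : ℝ) 1))) :
    MemLp ((Ioo (0 : ℝ) 1).indicator w) 2 volume :=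
  (memLp_indicator_iff_restrict measurableSet_Ioo).2 hw

/-- The sine system is complete in `L₂(0, 1)`. -/
theorem ae_eq_zero_of_sineTransform_eq_zero {w : ℝ → ℂ}
    (hw : MemLp w 2 (volume.restrict (Ioo (0 : ℝ) 1)))
    (h : ∀ z, sineTransform w z = 0) : ∀ᵐ x ∂(volume.restrict (Ioo (0 : ℝ) 1)), w x = 0 := by
  set W := (Ioo (0 : ℝ) 1).indicator w with hW
  have hWm : MemLp W 2 volume := memLp_indicator hw
  have hWn : MemLp (fun x => W (-x)) 2 volume :=
    hWm.comp_measurePreserving (Measure.measurePreserving_neg volume)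
  -- The odd extension of `w` to `(-1, 1)`. Its Fourier coefficients are multiples of the sine
  -- transform at the points `πn`, so all vanish, and Parseval gives `F = 0`.
  set F : ℝ → ℂ := fun x => W x - W (-x) with hF
  have hFm : MemLp F 2 volume := hWm.sub hWn
  have hab : (-1 : ℝ) < 1 := by norm_num
  have hWi : ∀ c d : ℝ, IntervalIntegrable W volume c d := fun c d =>
    ((hWm.locallyIntegrable (by norm_num)).integrableOn_isCompact isCompact_uIcc).intervalIntegrable
  have hWni : ∀ c d : ℝ, IntervalIntegrable (fun x => W (-x)) volume c d := fun c d =>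
    ((hWn.locallyIntegrable (by norm_num)).integrableOn_isCompact isCompact_uIcc).intervalIntegrable
  have hcoef : ∀ n : ℤ, fourierCoeffOn hab F n = 0 := by
    intro n
    rw [fourierCoeffOn_eq_integral]
    have hc : Continuous fun x : ℝ => (fourier (-n) (x : AddCircle ((1 : ℝ) - -1)) : ℂ) :=
      (fourier (-n)).continuous.comp (AddCircle.continuous_mk' _)
    set k : ℝ → ℂ := fun x => fourier (-n) (x : AddCircle ((1 : ℝ) - -1)) with hk
    have hcn : Continuous fun x => k (-x) := hc.comp continuous_neg
    have e0 : (∫ x in (-1 : ℝ)..1, k x • F x) = ∫ x in (-1 : ℝ)..1, (k x - k (-x)) * W x := by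
      have h1 : (∫ x in (-1 : ℝ)..1, k x * W (-x)) = ∫ x in (-1 : ℝ)..1, k (-x) * W x := by
        have := intervalIntegral.integral_comp_neg (a := -1) (b := 1) fun x => k (-x) * W x
        simpa using this
      simp only [hF, smul_eq_mul, mul_sub, sub_mul]
      rw [intervalIntegral.integral_sub ((hWi _ _).continuousOn_mul hc.continuousOn)
        ((hWni _ _).continuousOn_mul hc.continuousOn), h1,
        intervalIntegral.integral_sub ((hWi _ _).continuousOn_mul hc.continuousOn)
        ((hWi _ _).continuousOn_mul hcn.continuousOn)]
    have hkk : ∀ x, k x - k (-x) = -2 * Complex.I * Complex.sin ((Real.pi * n : ℂ) * x) := by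
      intro x
      simp only [hk, fourier_coe_apply]
      rw [Complex.sin]
      have e1 : 2 * (Real.pi : ℂ) * Complex.I * ((-n : ℤ) : ℂ) * (x : ℂ) / ((1 - -1 : ℝ) : ℂ) =
        -(Real.pi * n * x) * Complex.I := by push_cast; ring
      have e2 : 2 * (Real.pi : ℂ) * Complex.I * ((-n : ℤ) : ℂ) * ((-x : ℝ) : ℂ) / ((1 - -1 : ℝ) : ℂ) =
        (Real.pi * n * x) * Complex.I := by push_cast; ring
      rw [e1, e2]
      linear_combination (Complex.exp (-(Real.pi * n * x) * Complex.I) -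
        Complex.exp (Real.pi * n * x * Complex.I)) * Complex.I_mul_I
    have e1 : (∫ x in (-1 : ℝ)..0, (k x - k (-x)) * W x) = 0 := by
      refine (intervalIntegral.integral_congr_Ioo_of_le (by norm_num)
        (g := fun _ => (0 : ℂ)) fun x hx => ?_).trans (by simp)
      have : x ∉ Ioo (0 : ℝ) 1 := fun h => by linarith [hx.2, h.1]
      simp [hW, this]
    have e2 : (∫ x in (0 : ℝ)..1, (k x - k (-x)) * W x) =
        -2 * Complex.I * sineTransform w (Real.pi * n) := by
      rw [sineTransform, ← intervalIntegral.integral_const_mul]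
      refine intervalIntegral.integral_congr_Ioo_of_le zero_le_one fun x hx => ?_
      simp only [hW, indicator_of_mem hx, hkk]
      ring
    have hint : ∀ c d : ℝ, IntervalIntegrable (fun x => (k x - k (-x)) * W x) volume c d :=
      fun c d => (hWi c d).continuousOn_mul (hc.sub hcn).continuousOn
    rw [e0, ← intervalIntegral.integral_add_adjacent_intervals (hint (-1) 0) (hint 0 1), e1, e2, h]
    simp
  have hs := hasSum_sq_fourierCoeffOn hab (hFm.restrict (Ioc (-1 : ℝ) 1))
  simp only [hcoef, norm_zero, ne_eq, OfNat.ofNat_ne_zero, not_false_eq_true, zero_pow] at hs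
  have hz : (∫ x in (-1 : ℝ)..1, ‖F x‖ ^ 2) = 0 := by
    have := hs.unique hasSum_zero
    simpa using this
  rw [intervalIntegral.integral_of_le hab.le, setIntegral_eq_zero_iff_of_nonneg_ae
    (.of_forall fun _ => by positivity) ((memLp_two_iff_integrable_sq_norm
      (hFm.restrict _).1).1 (hFm.restrict _))] at hz
  have hz' := ae_restrict_of_ae_restrict_of_subset
    (show Ioo (0 : ℝ) 1 ⊆ Ioc (-1) 1 from fun x hx => ⟨by linarith [hx.1], hx.2.le⟩) hz
  filter_upwards [hz', ae_restrict_mem measurableSet_Ioo] with x hx hmem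
  have h1 : F x = 0 := by simpa using hx
  have : -x ∉ Ioo (0 : ℝ) 1 := fun h => by linarith [hmem.1, h.1]
  simpa [hF, hW, this, hmem] using h1

/-! ### The characteristic function as a sine transform of the shifted potential. -/

theorem sinRho_neg (lam : ℂ) (x : ℝ) : sinRho lam (-x) = -sinRho lam x := by
  have := sinRho_sub lam 0 x
  simpa [sinRho_zero, cosRho_zero] using this

theorem cosRho_neg (lam : ℂ) (x : ℝ) : cosRho lam (-x) = cosRho lam x := by
  have := cosRho_sub lam 0 x
  simpa [sinRho_zero, cosRho_zero] using this

theorem sinRho_add (lam : ℂ) (x t : ℝ) :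
    sinRho lam (x + t) = sinRho lam x * cosRho lam t + cosRho lam x * sinRho lam t := by
  rw [← sub_neg_eq_add, sinRho_sub, sinRho_neg, cosRho_neg]; ring

theorem cosRho_add (lam : ℂ) (x t : ℝ) :
    cosRho lam (x + t) = cosRho lam x * cosRho lam t - lam * (sinRho lam x * sinRho lam t) := by
  rw [← sub_neg_eq_add, cosRho_sub, sinRho_neg, cosRho_neg]; ring

theorem cosRho_sq_add (lam : ℂ) (x : ℝ) :
    cosRho lam x * cosRho lam x + lam * (sinRho lam x * sinRho lam x) = 1 := by
  rw [← cosRho_sub, sub_self, cosRho_zero]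

theorem integral_sinRho_sub {q : ℝ → ℂ} {c d : ℝ} (hq : IntervalIntegrable q volume c d)
    (lam : ℂ) (x : ℝ) : (∫ t in c..d, sinRho lam (x - t) * q t) =
      sinRho lam x * (∫ t in c..d, cosRho lam t * q t) -
        cosRho lam x * ∫ t in c..d, sinRho lam t * q t := by
  rw [← intervalIntegral.integral_const_mul, ← intervalIntegral.integral_const_mul,
    ← intervalIntegral.integral_sub
      ((hq.continuousOn_mul (continuous_cosRho lam).continuousOn).const_mul _)
      ((hq.continuousOn_mul (continuous_sinRho lam).continuousOn).const_mul _)]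
  refine intervalIntegral.integral_congr fun t _ => ?_
  simp only [sinRho_sub]; ring

theorem integral_cosRho_sub {q : ℝ → ℂ} {c d : ℝ} (hq : IntervalIntegrable q volume c d)
    (lam : ℂ) (x : ℝ) : (∫ t in c..d, cosRho lam (x - t) * q t) =
      cosRho lam x * (∫ t in c..d, cosRho lam t * q t) +
        lam * (sinRho lam x * ∫ t in c..d, sinRho lam t * q t) := by
  simp only [← intervalIntegral.integral_const_mul]
  rw [← intervalIntegral.integral_add
      ((hq.continuousOn_mul (continuous_cosRho lam).continuousOn).const_mul _)
      (((hq.continuousOn_mul (continuous_sinRho lam).continuousOn).const_mul _).const_mul _)]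
  refine intervalIntegral.integral_congr fun t _ => ?_
  simp only [cosRho_sub]; ring

/-- Extending `q` by zero turns the piecewise definition into a sum of two translates, the switching
point `1 - a` being negligible; square integrability then follows from translation invariance. -/
theorem shiftPotential_ae_eq (q : ℝ → ℂ) {a : ℝ} (ha : a ∈ Icc (0 : ℝ) 1) (γ : ℂ) :
    shiftPotential q a γ =ᵐ[volume.restrict (Ioo (0 : ℝ) 1)] fun x =>
      (Ioo (0 : ℝ) 1).indicator q (x + a) + γ⁻¹ * (Ioo (0 : ℝ) 1).indicator q (x + (a - 1)) := by
  have hne : ∀ᵐ x ∂(volume.restrict (Ioo (0 : ℝ) 1)), x ≠ 1 - a :=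
    ae_restrict_of_ae (Measure.ae_ne volume (1 - a))
  filter_upwards [hne, ae_restrict_mem measurableSet_Ioo] with x hx hm
  obtain ⟨h0, h1⟩ := hm
  obtain ⟨ha0, ha1⟩ := ha
  rcases lt_or_gt_of_ne hx with h | h
  · have m1 : x + a ∈ Ioo (0 : ℝ) 1 := ⟨by linarith, by linarith⟩
    have m2 : x + (a - 1) ∉ Ioo (0 : ℝ) 1 := fun k => by linarith [k.1]
    simp [shiftPotential, h, m1, m2]
  · have m1 : x + a ∉ Ioo (0 : ℝ) 1 := fun k => by linarith [k.2]
    have m2 : x + (a - 1) ∈ Ioo (0 : ℝ) 1 := ⟨by linarith, by linarith⟩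
    simp [shiftPotential, not_lt.2 h.le, m1, m2, add_sub_assoc]

theorem memLp_shiftPotential {q : ℝ → ℂ} (hq : MemLp q 2 (volume.restrict (Ioo (0 : ℝ) 1)))
    {a : ℝ} (ha : a ∈ Icc (0 : ℝ) 1) (γ : ℂ) :
    MemLp (shiftPotential q a γ) 2 (volume.restrict (Ioo (0 : ℝ) 1)) := by
  rw [memLp_congr_ae (shiftPotential_ae_eq q ha γ)]
  have h := memLp_indicator hq
  exact ((h.comp_measurePreserving (measurePreserving_add_right volume a)).add
    ((h.comp_measurePreserving (measurePreserving_add_right volume (a - 1))).const_mul γ⁻¹)).restrict _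

theorem integral_shiftPotential_mul {q : ℝ → ℂ}
    (hq : MemLp q 2 (volume.restrict (Ioo (0 : ℝ) 1))) {a : ℝ} (ha : a ∈ Icc (0 : ℝ) 1) (γ : ℂ)
    {k : ℝ → ℂ} (hk : Continuous k) :
    (∫ s in (0 : ℝ)..1, shiftPotential q a γ s * k s) =
      (∫ t in a..1, q t * k (t - a)) + γ⁻¹ * ∫ t in (0 : ℝ)..a, q t * k (t - (a - 1)) := by
  have hi := (intervalIntegrable_of_memLp (memLp_shiftPotential hq ha γ)).mul_continuousOn
    hk.continuousOn
  have hm : (1 - a) ∈ uIcc (0 : ℝ) 1 := by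
    rw [uIcc_of_le zero_le_one]; exact ⟨by linarith [ha.2], by linarith [ha.1]⟩
  rw [← intervalIntegral.integral_add_adjacent_intervals (b := 1 - a)
    (hi.mono_set (uIcc_subset_uIcc_left hm)) (hi.mono_set (uIcc_subset_uIcc_right hm))]
  congr 1
  · have := intervalIntegral.integral_comp_add_right (a := 0) (b := 1 - a)
      (fun t => q t * k (t - a)) a
    simp only [add_sub_cancel_right, zero_add, sub_add_cancel] at this
    rw [← this]
    refine intervalIntegral.integral_congr_Ioo_of_le (by linarith [ha.2]) fun x hx => ?_
    simp [shiftPotential, hx.2]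
  · have := intervalIntegral.integral_comp_add_right (a := 1 - a) (b := 1)
      (fun t => q t * k (t - (a - 1))) (a - 1)
    simp only [add_sub_cancel_right, sub_add_sub_cancel, sub_self, add_sub_cancel] at this
    rw [← this, ← intervalIntegral.integral_const_mul]
    refine intervalIntegral.integral_congr_Ioo_of_le (by linarith [ha.1]) fun x hx => ?_
    simp only [shiftPotential, not_lt.2 hx.1.le, if_false, add_sub_assoc]
    ring

/-- The function whose sine transform enters the characteristic function. -/
noncomputable def sineWeight (q : ℝ → ℂ) (a : ℝ) (γ : ℂ) (s : ℝ) : ℂ :=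
  γ * shiftPotential q a γ s + shiftPotential q a γ (1 - s)

theorem measurePreserving_one_sub :
    MeasurePreserving (fun x : ℝ => 1 - x) (volume.restrict (Ioo (0 : ℝ) 1))
      (volume.restrict (Ioo (0 : ℝ) 1)) := by
  have h := (Measure.measurePreserving_sub_left (volume : Measure ℝ) 1).restrict_preimage
    (measurableSet_Ioo (a := (0 : ℝ)) (b := 1))
  have e : (fun x : ℝ => 1 - x) ⁻¹' Ioo (0 : ℝ) 1 = Ioo 0 1 := by simp
  rwa [e] at h

theorem memLp_sineWeight {q : ℝ → ℂ} (hq : MemLp q 2 (volume.restrict (Ioo (0 : ℝ) 1)))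
    {a : ℝ} (ha : a ∈ Icc (0 : ℝ) 1) (γ : ℂ) :
    MemLp (sineWeight q a γ) 2 (volume.restrict (Ioo (0 : ℝ) 1)) :=
  ((memLp_shiftPotential hq ha γ).const_mul γ).add
    ((memLp_shiftPotential hq ha γ).comp_measurePreserving measurePreserving_one_sub)

theorem integral_sineWeight_mul {q : ℝ → ℂ} (hq : MemLp q 2 (volume.restrict (Ioo (0 : ℝ) 1)))
    {a : ℝ} (ha : a ∈ Icc (0 : ℝ) 1) (γ lam : ℂ) :
    (∫ s in (0 : ℝ)..1, sineWeight q a γ s * sinRho lam s) =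
      ∫ s in (0 : ℝ)..1, shiftPotential q a γ s * (γ * sinRho lam s + sinRho lam (1 - s)) := by
  have hc := continuous_sinRho lam
  have hp := memLp_shiftPotential hq ha γ
  have i1 := intervalIntegrable_of_memLp hp
  have i2 := intervalIntegrable_of_memLp (hp.comp_measurePreserving measurePreserving_one_sub)
  have e : (∫ s in (0 : ℝ)..1, shiftPotential q a γ (1 - s) * sinRho lam s) =
      ∫ s in (0 : ℝ)..1, shiftPotential q a γ s * sinRho lam (1 - s) := by
    have := intervalIntegral.integral_comp_sub_left (a := 0) (b := 1)
      (fun s => shiftPotential q a γ s * sinRho lam (1 - s)) 1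
    simpa using this
  simp only [sineWeight, add_mul, mul_add]
  rw [intervalIntegral.integral_add, intervalIntegral.integral_add, e]
  · congr 1
    refine intervalIntegral.integral_congr fun s _ => ?_
    ring
  · exact i1.mul_continuousOn (by fun_prop)
  · exact i1.mul_continuousOn (by fun_prop)
  · exact (i1.const_mul γ).mul_continuousOn hc.continuousOn
  · exact i2.mul_continuousOn hc.continuousOn

/-- After the addition formulas are applied, both sides are affine in the cosine and sine moments of
`q` over `(0, a)` and `(a, 1)`. What remains is a polynomial identity modulo the Pythagorean
relations at `a` and at `1`. -/
theorem characteristicFn_eq {q : ℝ → ℂ} (hq : MemLp q 2 (volume.restrict (Ioo (0 : ℝ) 1)))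
    {a : ℝ} (ha : a ∈ Icc (0 : ℝ) 1) {γ : ℂ} (hγ : γ ≠ 0) (lam : ℂ) :
    characteristicFn q a γ lam = charRho γ (sineWeight q a γ) (rho lam) := by
  have hqi := intervalIntegrable_of_memLp hq
  have hau : a ∈ uIcc (0 : ℝ) 1 := by rwa [uIcc_of_le zero_le_one]
  have q0 : IntervalIntegrable q volume 0 a := hqi.mono_set (uIcc_subset_uIcc_left hau)
  have q1 : IntervalIntegrable q volume a 1 := hqi.mono_set (uIcc_subset_uIcc_right hau)
  have hc := continuous_sinRho lam
  -- Used with `x = a` on `(a, 1)` and with `x = a - 1` on `(0, a)`, the two shifts hidden in `q_a`.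
  have swap : ∀ {c d : ℝ}, IntervalIntegrable q volume c d → ∀ x : ℝ,
      (∫ t in c..d, q t * (γ * sinRho lam (t - x) + sinRho lam (1 - (t - x)))) =
      -γ * (∫ t in c..d, sinRho lam (x - t) * q t) +
        ∫ t in c..d, sinRho lam (1 + x - t) * q t := by
    intro c d hcd x
    rw [← intervalIntegral.integral_const_mul, ← intervalIntegral.integral_add]
    · refine intervalIntegral.integral_congr fun t _ => ?_
      rw [← neg_sub x t, sinRho_neg, show 1 - -(x - t) = 1 + x - t by ring]
      ring
    · exact (hcd.continuousOn_mul (by fun_prop)).const_mul _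
    · exact hcd.continuousOn_mul (by fun_prop)
  rw [charRho_rho γ (intervalIntegrable_of_memLp (memLp_sineWeight hq ha γ)),
    integral_sineWeight_mul hq ha, integral_shiftPotential_mul hq ha γ
      (k := fun s => γ * sinRho lam s + sinRho lam (1 - s)) (by fun_prop), swap q1, swap q0,
    characteristicFn, Matrix.det_fin_two_of]
  simp only [solC, solC', solS, solS', intervalIntegral.integral_symm 0 a,
    integral_sinRho_sub q0, integral_sinRho_sub q1, integral_cosRho_sub q0,
    integral_cosRho_sub q1]
  simp only [sinRho_sub, cosRho_sub, sinRho_add, cosRho_add, sinRho_zero,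
    cosRho_zero]
  have ea := cosRho_sq_add lam a
  have e1 := cosRho_sq_add lam 1
  generalize (∫ t in (0 : ℝ)..a, cosRho lam t * q t) = A0
  generalize (∫ t in (0 : ℝ)..a, sinRho lam t * q t) = B0
  generalize (∫ t in a..1, cosRho lam t * q t) = A1
  generalize (∫ t in a..1, sinRho lam t * q t) = B1
  generalize sinRho lam a = s at *
  generalize cosRho lam a = c at *
  generalize sinRho lam 1 = S at *
  generalize cosRho lam 1 = C at *
  field_simp
  linear_combination (1 + γ ^ 2 * (C ^ 2 + lam * S ^ 2) - 2 * γ * C) * ea +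
    (γ ^ 2 + γ ^ 2 * (s * A1 - c * B1) + (s * A0 - c * B0)) * e1

/-! ### Zeros of the characteristic function are eigenvalues. -/

/-- `y'` agrees on `[0, 1]` with a primitive of an integrable function, hence with a continuous one.
Additivity of the integral in linear combinations of solutions requires this. -/
theorem IsSolution.intervalIntegrable_deriv {q : ℝ → ℂ} {a : ℝ} {lam : ℂ} {y y' : ℝ → ℂ}
    (h : IsSolution q a lam y y') : IntervalIntegrable y' volume 0 1 := by
  obtain ⟨y'', ⟨h1, -, h3⟩, -⟩ := h
  have hc : ContinuousOn (fun x => y' 0 + ∫ t in (0 : ℝ)..x, y'' t) (uIcc 0 1) := by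
    refine continuousOn_const.add ?_
    simpa using (ac_integral (intervalIntegrable_of_memLp h1) (c := 0) (by simp)).continuousOn
  refine hc.intervalIntegrable.congr fun x hx => ?_
  rw [uIoc_of_le zero_le_one] at hx
  exact (h3 x ⟨hx.1.le, hx.2⟩).symm

/-- Linear combinations of solutions are solutions. -/
theorem IsSolution.linear_combination {q : ℝ → ℂ} {a : ℝ} {lam : ℂ} {y y' z z' : ℝ → ℂ}
    (hy : IsSolution q a lam y y') (hz : IsSolution q a lam z z') (α β : ℂ) :
    IsSolution q a lam (fun x => α * y x + β * z x) (fun x => α * y' x + β * z' x) := by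
  have iy := hy.intervalIntegrable_deriv
  have iz := hz.intervalIntegrable_deriv
  obtain ⟨y'', ⟨h1, h2, h3⟩, h4⟩ := hy
  obtain ⟨z'', ⟨k1, k2, k3⟩, k4⟩ := hz
  have iy2 := intervalIntegrable_of_memLp h1
  have iz2 := intervalIntegrable_of_memLp k1
  have hsub : ∀ x ∈ Icc (0 : ℝ) 1, uIcc 0 x ⊆ uIcc 0 1 := fun x hx =>
    uIcc_subset_uIcc_left (by rwa [uIcc_of_le zero_le_one])
  refine ⟨fun x => α * y'' x + β * z'' x,
    ⟨(h1.const_mul α).add (k1.const_mul β), fun x hx => ?_, fun x hx => ?_⟩, ?_⟩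
  · rw [intervalIntegral.integral_add ((iy.mono_set (hsub x hx)).const_mul _)
      ((iz.mono_set (hsub x hx)).const_mul _), intervalIntegral.integral_const_mul,
      intervalIntegral.integral_const_mul, h2 x hx, k2 x hx]
    ring
  · rw [intervalIntegral.integral_add ((iy2.mono_set (hsub x hx)).const_mul _)
      ((iz2.mono_set (hsub x hx)).const_mul _), intervalIntegral.integral_const_mul,
      intervalIntegral.integral_const_mul, h3 x hx, k3 x hx]
    ring
  · filter_upwards [h4, k4] with x hx kx
    linear_combination α * hx + β * kx

/-- `S` does not vanish identically. -/
theorem exists_solS_ne_zero {a : ℝ} (ha : a ∈ Icc (0 : ℝ) 1) (lam : ℂ) :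
    ∃ x ∈ Icc (0 : ℝ) 1, solS a lam x ≠ 0 := by
  by_contra! hcon
  have h1 : HasDerivWithinAt (solS a lam) 1 (Icc 0 1) a := by
    have := (hasDerivAt_solS a lam a).hasDerivWithinAt (s := Icc 0 1)
    rwa [(solS_init a lam).2] at this
  have h2 : HasDerivWithinAt (solS a lam) 0 (Icc 0 1) a :=
    (hasDerivWithinAt_const a (Icc 0 1) (0 : ℂ)).congr hcon (hcon a ha)
  exact one_ne_zero ((uniqueDiffOn_Icc zero_lt_one a ha).eq_deriv _ h1 h2)

/-- The zeros of the characteristic function are eigenvalues. -/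
theorem isEigenvalue_of_characteristicFn_eq_zero {q : ℝ → ℂ}
    (hq : MemLp q 2 (volume.restrict (Ioo (0 : ℝ) 1))) {a : ℝ} (ha : a ∈ Icc (0 : ℝ) 1)
    {γ lam : ℂ} (h : characteristicFn q a γ lam = 0) : IsEigenvalue q a γ lam := by
  obtain ⟨v, hv, hvm⟩ := Matrix.exists_mulVec_eq_zero_iff.2 h
  have e0 := congrFun hvm 0
  have e1 := congrFun hvm 1
  simp [Matrix.mulVec, dotProduct, Fin.sum_univ_two] at e0 e1
  refine ⟨_, _, (solC_isSolution hq ha lam).linear_combination (solS_isSolution q a lam) (v 0) (v 1),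
    ?_, ?_, ?_⟩
  · linear_combination e0
  · linear_combination e1
  -- Nontriviality: the combination takes the value `v 0` at `a`, and if `v 0 = 0` it is a nonzero
  -- multiple of `S`.
  · by_cases h0 : v 0 = 0
    · have h1 : v 1 ≠ 0 := fun h1 => hv (by ext i; fin_cases i <;> simp [h0, h1])
      obtain ⟨x, hx, hne⟩ := exists_solS_ne_zero ha lam
      exact ⟨x, hx, by simpa [h0] using ⟨h1, hne⟩⟩
    · exact ⟨a, ha, by simpa [(solC_init q a lam).1, (solS_init a lam).1] using h0⟩

/-- The multiplicity in the spectrum is the order of the zero of the characteristic function. -/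
theorem spectrumMult_eq {q : ℝ → ℂ} (hq : MemLp q 2 (volume.restrict (Ioo (0 : ℝ) 1))) {a : ℝ}
    (ha : a ∈ Icc (0 : ℝ) 1) (γ lam : ℂ) :
    spectrumMult q a γ lam = analyticOrderAt (characteristicFn q a γ) lam := by
  rw [spectrumMult]
  split_ifs with h
  · rfl
  · rw [eq_comm, analyticOrderAt_eq_zero]
    exact Or.inr fun h0 => h (isEigenvalue_of_characteristicFn_eq_zero hq ha h0)

/-! ### From the spectrum back to the potential. -/

/-- The spectrum determines the combination `γ q_a(x) + q_a(1 - x)`. -/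
theorem sineWeight_ae_eq_of_spectrumMult_eq {q₁ q₂ : ℝ → ℂ}
    (hq₁ : MemLp q₁ 2 (volume.restrict (Ioo (0 : ℝ) 1)))
    (hq₂ : MemLp q₂ 2 (volume.restrict (Ioo (0 : ℝ) 1))) {a : ℝ} (ha : a ∈ Icc (0 : ℝ) 1)
    {γ : ℂ} (hγ : γ ≠ 0) (h : ∀ lam, spectrumMult q₁ a γ lam = spectrumMult q₂ a γ lam) :
    ∀ᵐ x ∂(volume.restrict (Ioo (0 : ℝ) 1)), sineWeight q₁ a γ x = sineWeight q₂ a γ x := by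
  have m1 := memLp_sineWeight hq₁ ha γ
  have m2 := memLp_sineWeight hq₂ ha γ
  have i1 := intervalIntegrable_of_memLp m1
  have i2 := intervalIntegrable_of_memLp m2
  have heq := sineTransform_eq_of_order_eq hγ i1 i2 fun l => by
    have := h l
    rwa [spectrumMult_eq hq₁ ha, spectrumMult_eq hq₂ ha,
      funext (characteristicFn_eq hq₁ ha hγ), funext (characteristicFn_eq hq₂ ha hγ)] at this
  have hz := ae_eq_zero_of_sineTransform_eq_zero (m1.sub m2) fun z => by
    have e : sineTransform (sineWeight q₁ a γ - sineWeight q₂ a γ) z =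
        sineTransform (sineWeight q₁ a γ) z - sineTransform (sineWeight q₂ a γ) z := by
      simp only [sineTransform, Pi.sub_apply, sub_mul]
      exact intervalIntegral.integral_sub (i1.mul_continuousOn (by fun_prop))
        (i2.mul_continuousOn (by fun_prop))
    rw [e, heq, sub_self]
  filter_upwards [hz] with x hx
  exact sub_eq_zero.1 hx

theorem ae_restrict_comp_add_right {P : ℝ → Prop} {c d b : ℝ}
    (h : ∀ᵐ x ∂(volume.restrict (Ioo (c + b) (d + b))), P x) :
    ∀ᵐ x ∂(volume.restrict (Ioo c d)), P (x + b) := by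
  have hm := (measurePreserving_add_right (volume : Measure ℝ) b).restrict_preimage
    (measurableSet_Ioo (a := c + b) (b := d + b))
  have e : (fun x : ℝ => x + b) ⁻¹' Ioo (c + b) (d + b) = Ioo c d := by simp
  rw [e] at hm
  exact hm.quasiMeasurePreserving.ae h

theorem ae_restrict_comp_sub_left {P : ℝ → Prop} {c d b : ℝ}
    (h : ∀ᵐ x ∂(volume.restrict (Ioo (b - d) (b - c))), P x) :
    ∀ᵐ x ∂(volume.restrict (Ioo c d)), P (b - x) := by
  have hm := (Measure.measurePreserving_sub_left (volume : Measure ℝ) b).restrict_preimage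
    (measurableSet_Ioo (a := b - d) (b := b - c))
  have e : (fun x : ℝ => b - x) ⁻¹' Ioo (b - d) (b - c) = Ioo c d := by simp
  rw [e] at hm
  exact hm.quasiMeasurePreserving.ae h

theorem ae_restrict_Ioo_of_split {P : ℝ → Prop} {c m d : ℝ}
    (h1 : ∀ᵐ x ∂(volume.restrict (Ioo c m)), P x) (h2 : ∀ᵐ x ∂(volume.restrict (Ioo m d)), P x) :
    ∀ᵐ x ∂(volume.restrict (Ioo c d)), P x := by
  rw [ae_restrict_iff' measurableSet_Ioo] at *
  filter_upwards [h1, h2, Measure.ae_ne volume m] with x hx1 hx2 hne hx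
  rcases lt_or_gt_of_ne hne with h | h
  · exact hx1 ⟨hx.1, h⟩
  · exact hx2 ⟨h, hx.2⟩

theorem ae_restrict_Ioo_mono {P : ℝ → Prop} {c d c' d' : ℝ} (hc : c ≤ c') (hd : d' ≤ d)
    (h : ∀ᵐ x ∂(volume.restrict (Ioo c d)), P x) : ∀ᵐ x ∂(volume.restrict (Ioo c' d')), P x :=
  ae_restrict_of_ae_restrict_of_subset (Ioo_subset_Ioo hc hd) h

/-- `q` is determined by `q_a`. -/
theorem ae_eq_of_shiftPotential_ae_eq {q₁ q₂ : ℝ → ℂ} {a : ℝ} (ha : a ∈ Icc (0 : ℝ) 1) {γ : ℂ}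
    (hγ : γ ≠ 0) (h : ∀ᵐ x ∂(volume.restrict (Ioo (0 : ℝ) 1)),
      shiftPotential q₁ a γ x = shiftPotential q₂ a γ x) :
    ∀ᵐ x ∂(volume.restrict (Ioo (0 : ℝ) 1)), q₁ x = q₂ x := by
  obtain ⟨ha0, ha1⟩ := ha
  refine ae_restrict_Ioo_of_split (m := a) ?_ ?_
  · have h1 := ae_restrict_comp_add_right (c := 0) (d := a) (b := 1 - a)
      (ae_restrict_Ioo_mono (by linarith) (by linarith) h)
    filter_upwards [h1, ae_restrict_mem measurableSet_Ioo] with x hx hm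
    have hn : ¬ x + (1 - a) < 1 - a := by linarith [hm.1]
    simp only [shiftPotential, hn, if_false] at hx
    have hx' := mul_left_cancel₀ (inv_ne_zero hγ) hx
    rwa [show x + (1 - a) + a - 1 = x by ring] at hx'
  · have h1 := ae_restrict_comp_add_right (c := a) (d := 1) (b := -a)
      (ae_restrict_Ioo_mono (by linarith) (by linarith) h)
    filter_upwards [h1, ae_restrict_mem measurableSet_Ioo] with x hx hm
    have hn : x + -a < 1 - a := by linarith [hm.2]
    simpa only [shiftPotential, hn, if_true, neg_add_cancel_right] using hx

/-- For `γ² ≠ 1` the combination `γ q_a(x) + q_a(1 - x)` determines `q_a`. -/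
theorem shiftPotential_ae_eq_of_sineWeight {q₁ q₂ : ℝ → ℂ} {a : ℝ} {γ : ℂ} (h1 : γ ≠ 1)
    (h2 : γ ≠ -1) (h : ∀ᵐ x ∂(volume.restrict (Ioo (0 : ℝ) 1)),
      sineWeight q₁ a γ x = sineWeight q₂ a γ x) :
    ∀ᵐ x ∂(volume.restrict (Ioo (0 : ℝ) 1)),
      shiftPotential q₁ a γ x = shiftPotential q₂ a γ x := by
  -- The reflected relation at `1 - x` is the second equation of the linear system; eliminating
  -- `q_a(1 - x)` leaves the factor `γ² - 1`.
  have h' := ae_restrict_comp_sub_left (c := 0) (d := 1) (b := 1) (by simpa using h)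
  have hne : (γ - 1) * (γ + 1) ≠ 0 :=
    mul_ne_zero (sub_ne_zero.2 h1) fun h => h2 (eq_neg_of_add_eq_zero_left h)
  filter_upwards [h, h'] with x hx hx'
  simp only [sineWeight, sub_sub_cancel] at hx hx'
  refine mul_left_cancel₀ hne ?_
  linear_combination γ * hx - hx'

/-- For `γ = ±1` the combination `γ q_a(x) + q_a(1 - x)` determines `q_a` under the half
relation. -/
theorem shiftPotential_ae_eq_of_halfRelation {q₁ q₂ : ℝ → ℂ} {a : ℝ} {γ : ℂ} (hγ : γ * γ = 1)
    {K : L2Half → L2Half} (hK : Function.Injective fun f : L2Half => f + γ • K f)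
    (r1 : HalfRelation K (shiftPotential q₁ a γ)) (r2 : HalfRelation K (shiftPotential q₂ a γ))
    (h : ∀ᵐ x ∂(volume.restrict (Ioo (0 : ℝ) 1)), sineWeight q₁ a γ x = sineWeight q₂ a γ x) :
    ∀ᵐ x ∂(volume.restrict (Ioo (0 : ℝ) 1)),
      shiftPotential q₁ a γ x = shiftPotential q₂ a γ x := by
  obtain ⟨u, hu, hKu⟩ := r1
  obtain ⟨v, hv, hKv⟩ := r2
  have hw := ae_restrict_comp_add_right (c := 0) (d := 1 / 2) (b := 1 / 2)
    (ae_restrict_Ioo_mono (by norm_num) (by norm_num) h)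
  have huv : u = v := by
    -- At `1/2 + x` the weight is `γ u + K u`; multiplication by `γ` with `γ² = 1` turns it into `u
    -- + γ K u`, where injectivity applies.
    refine hK (Lp.ext ?_)
    filter_upwards [hu, hKu, hv, hKv, hw, Lp.coeFn_add u (γ • K u), Lp.coeFn_add v (γ • K v),
      Lp.coeFn_smul γ (K u), Lp.coeFn_smul γ (K v)] with x a1 a2 b1 b2 hx s1 s2 t1 t2
    simp only [sineWeight] at hx
    rw [add_comm x, show (1 : ℝ) - (1 / 2 + x) = 1 / 2 - x by ring] at hx
    simp only [s1, s2, Pi.add_apply, t1, t2, Pi.smul_apply, smul_eq_mul, a1, b1, ← a2, ← b2]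
    linear_combination γ * hx - (shiftPotential q₁ a γ (1 / 2 + x) -
      shiftPotential q₂ a γ (1 / 2 + x)) * hγ
  subst huv
  refine ae_restrict_Ioo_of_split (m := 1 / 2) ?_ ?_
  · have : ∀ᵐ x ∂(volume.restrict (Ioo (0 : ℝ) (1 / 2))),
        shiftPotential q₁ a γ (1 / 2 - x) = shiftPotential q₂ a γ (1 / 2 - x) := by
      filter_upwards [hKu, hKv] with x h1 h2
      rw [h1, h2]
    have h2 := ae_restrict_comp_sub_left (c := 0) (d := 1 / 2) (b := 1 / 2) (by simpa using this)
    simpa using h2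
  · have : ∀ᵐ x ∂(volume.restrict (Ioo (0 : ℝ) (1 / 2))),
        shiftPotential q₁ a γ (1 / 2 + x) = shiftPotential q₂ a γ (1 / 2 + x) := by
      filter_upwards [hu, hv] with x h1 h2
      rw [← h1, ← h2]
    have h2 := ae_restrict_comp_add_right (c := 1 / 2) (d := 1) (b := -(1 / 2)) (by
      norm_num at this ⊢; exact this)
    simpa using h2

end FrozenHill

theorem theorem2 (a : ℝ) (ha : a ∈ Set.Icc (0 : ℝ) 1) (γ : ℂ) (hγ : γ ≠ 0) (q₁ q₂ : ℝ → ℂ)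
    (hq₁ : MeasureTheory.MemLp q₁ 2 (MeasureTheory.volume.restrict (Set.Ioo (0 : ℝ) 1)))
    (hq₂ : MeasureTheory.MemLp q₂ 2 (MeasureTheory.volume.restrict (Set.Ioo (0 : ℝ) 1))) :
    (γ ≠ 1 → γ ≠ -1 →
      (∀ lam : ℂ, FrozenHill.spectrumMult q₁ a γ lam = FrozenHill.spectrumMult q₂ a γ lam) →
      ∀ᵐ x ∂(MeasureTheory.volume.restrict (Set.Ioo (0 : ℝ) 1)), q₁ x = q₂ x) ∧
    (γ = 1 ∨ γ = -1 →
      (∃ K : FrozenHill.L2Half → FrozenHill.L2Half,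
        Function.Injective (fun f : FrozenHill.L2Half => f + γ • K f) ∧
        FrozenHill.HalfRelation K (FrozenHill.shiftPotential q₁ a γ) ∧
        FrozenHill.HalfRelation K (FrozenHill.shiftPotential q₂ a γ)) →
      (∀ lam : ℂ, FrozenHill.spectrumMult q₁ a γ lam = FrozenHill.spectrumMult q₂ a γ lam) →
      ∀ᵐ x ∂(MeasureTheory.volume.restrict (Set.Ioo (0 : ℝ) 1)), q₁ x = q₂ x) := by
  refine ⟨fun h1 h2 hs => ?_, fun h1 ⟨K, hK, r1, r2⟩ hs => ?_⟩
  · exact FrozenHill.ae_eq_of_shiftPotential_ae_eq ha hγ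
      (FrozenHill.shiftPotential_ae_eq_of_sineWeight h1 h2
        (FrozenHill.sineWeight_ae_eq_of_spectrumMult_eq hq₁ hq₂ ha hγ hs))
  · have hγγ : γ * γ = 1 := by rcases h1 with rfl | rfl <;> norm_num
    exact FrozenHill.ae_eq_of_shiftPotential_ae_eq ha hγ
      (FrozenHill.shiftPotential_ae_eq_of_halfRelation hγγ hK r1 r2
        (FrozenHill.sineWeight_ae_eq_of_spectrumMult_eq hq₁ hq₂ ha hγ hs))
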